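/- Let $T>0$, $H\in(1/2,1)$ and $a,b\in\mathbb R$ with $ab\neq0$. Write $\mathbf 1_t=\mathbf 1_{[0,t)}$ and $$c(H)=\sqrt{\frac{2H\,\Gamma(\frac32-H)}{\Gamma(H+\frac12)\,\Gamma(2-2H)}}\Bigl(H-\tfrac12\Bigr),$$ let $$K_H(t,s)=c(H)\,s^{\frac12-H}\int_s^t u^{H-\frac12}(u-s)^{H-\frac32}\,du\quad(0<s<t),\qquad K_H(t,s)=0\quad(s\ge t),$$ be the Molchan–Golosov kernel, put $L(t,s)=a\mathbf 1_t(s)+bK_H(t,s)$ and $$L^{-1}(t,s)=\frac1a\mathbf 1_t(s)+\frac1a\sum_{k=1}^\infty(-1)^k\Bigl(\frac ba\Bigr)^k\gamma_k(t,s),$$ $$\gamma_k(t,s)=\frac{c(H)^k\,\Gamma(H-\frac12)^k}{\Gamma(k(H-\frac12))}\,s^{\frac12-H}\int_s^t u^{H-\frac12}(u-s)^{k(H-\frac12)-1}\,du\quad(0<s<t),\qquad\gamma_k(t,s)=0\quad(s\ge t).$$ For a centered square-integrable process $Z=(Z_t)_{t\in[0,T]}$ let $\Lambda_Z$ be the closure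 of the linear combinations of the functions $\mathbf 1_t$, $t\in[0,T]$, under the inner product generated by $\langle\mathbf 1_t,\mathbf 1_s\rangle=\mathbb E[Z_tZ_s]$. A function $f\in L^2([0,T])$ is regarded as an element of $\Lambda_Z$ if some sequence of such step functions is Cauchy for this inner product and converges to $f$ in $L^2([0,T])$. The abstract Wiener integral $\int_0^T f\,dZ$ is the image of $f$ under the isometry $\mathbf 1_t\mapsto Z_t$ into $L^2(\Omega)$, that is, the common $L^2(\Omega)$-limit of the integrals of all such sequences; $\int_0^tf\,dZ=\int_0^Tf\mathbf 1_t\,dZ$. Let $X=aB+bB^H$ be the completely correlated mixed fractional Brownian motion on $[0,T]$ driven by a Brownian motion $B$, where $B^H_t=\int_0^tK_H(t,s)\,dB_s$. Then $X$ is an invertible Gaussian Volterra process in the following sense. 1. For all $s,t\in(0,T]$ the series defining $L^{-1}(t,s)$ converges, and for every $t\in[0,T]$ the abstract Wiener integral $$W_t=\int_0^tL^{-1}(t,s)\,dX_s$$ exists. 2. The process $W=(W_t)_{t\in[0,T]}$ is a Brownian motion: it has the finite-dimensional laws of Brownian motion, and it has a modification with almost surely continuous paths. Moreover, it is the driving Brownian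 motion: $W_t=B_t$ almost surely for every $t\in[0,T]$. 3. Conversely, $X$ is reconstructed from $W$ by the Wiener integral $$X_t=\int_0^tL(t,s)\,dW_s,\qquad t\in[0,T].$$ -/

import Mathlib

open MeasureTheory ProbabilityTheory Filter Topology

noncomputable section

namespace CCMFBM

variable {Ω : Type*} [MeasurableSpace Ω]

/-! ### Kernels -/

/-- The indicator function `𝟏_t = 𝟏_{[0,t)}`. -/
def ind (t s : ℝ) : ℝ := (Set.Ico (0 : ℝ) t).indicator (fun _ => (1 : ℝ)) s

/-- The normalizing constant `c(H)` of the Molchan–Golosov kernel. -/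
def mgConst (H : ℝ) : ℝ :=
  Real.sqrt (2 * H * Real.Gamma (3 / 2 - H) / (Real.Gamma (H + 1 / 2) * Real.Gamma (2 - 2 * H)))
    * (H - 1 / 2)

/-- The Molchan–Golosov kernel `K_H(t,s)`; it is of Volterra type, i.e. zero for `s ≥ t`. -/
def mgKernel (H t s : ℝ) : ℝ :=
  if s < t then
    mgConst H * (1 / s ^ (H - 1 / 2)) *
      ∫ u in s..t, u ^ (H - 1 / 2) / (u - s) ^ (3 / 2 - H)
  else 0

/-- The kernel `L(t,s) = a 𝟏_t(s) + b K_H(t,s)`. -/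
def kernelL (a b H t s : ℝ) : ℝ := a * ind t s + b * mgKernel H t s

/-- The functions `γ_k(t,s)`, `k ≥ 1`; zero for `s ≥ t`. -/
def gammaKernel (H : ℝ) (k : ℕ) (t s : ℝ) : ℝ :=
  if s < t then
    mgConst H ^ k * Real.Gamma (H - 1 / 2) ^ k / Real.Gamma (k * (H - 1 / 2)) *
      (1 / s ^ (H - 1 / 2)) *
      ∫ u in s..t, u ^ (H - 1 / 2) * (u - s) ^ (k * (H - 1 / 2) - 1)
  else 0

/-- The `n`-th term, which is the one with `k = n + 1 ≥ 1`, of the series in the kernel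
`L⁻¹(t,s)`. -/
def kernelLinvTerm (a b H t s : ℝ) (n : ℕ) : ℝ :=
  (-1) ^ (n + 1) * (b / a) ^ (n + 1) * gammaKernel H (n + 1) t s

/-- The kernel `L⁻¹(t,s) = a⁻¹ 𝟏_t(s) + a⁻¹ ∑_{k ≥ 1} (-1)^k (b/a)^k γ_k(t,s)`. -/
def kernelLinv (a b H t s : ℝ) : ℝ :=
  1 / a * ind t s + 1 / a * ∑' n : ℕ, kernelLinvTerm a b H t s n

/-! ### Step functions, the space `Λ`, and the abstract Wiener integral -/

/-- A finitely supported `c` encodes the formal combination `∑ c_t 𝟏_t`;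
this is the corresponding step function. -/
def stepFun (c : ℝ →₀ ℝ) (s : ℝ) : ℝ := c.sum fun t x => x * ind t s

/-- The integral `∑ c_t X_t` of the step function `∑ c_t 𝟏_t`. -/
def stepInt (X : ℝ → Ω → ℝ) (c : ℝ →₀ ℝ) (ω : Ω) : ℝ := c.sum fun t x => x * X t ω

/-- The covariance function `R(t,s) = E[X_t X_s]` of a centered process `X`. -/
def covFun (P : Measure Ω) (X : ℝ → Ω → ℝ) (t s : ℝ) : ℝ := ∫ ω, X t ω * X s ω ∂P

/-- The inner product on formal step functions generated by `⟨𝟏_t, 𝟏_s⟩_Λ = R(t,s)`. -/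
def lambdaInner (R : ℝ → ℝ → ℝ) (c d : ℝ →₀ ℝ) : ℝ :=
  c.sum fun t x => d.sum fun s y => x * y * R t s

/-- The sequence `φ` of step functions on `[0,T]` exhibits the function `f` as an element of the
closure `Λ` of the step functions for the inner product `⟨·,·⟩_Λ` of `X`: `φ` is a Cauchy sequence
for `⟨·,·⟩_Λ`, and the function that it approximates (in `L²([0,T])`) is `f`. -/
structure IsLambdaApprox (P : Measure Ω) (T : ℝ) (X : ℝ → Ω → ℝ) (f : ℝ → ℝ)
    (φ : ℕ → ℝ →₀ ℝ) : Prop where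
  support_subset : ∀ n, ((φ n).support : Set ℝ) ⊆ Set.Icc 0 T
  tendsto : Tendsto
    (fun n => eLpNorm (fun s => stepFun (φ n) s - f s) 2 (volume.restrict (Set.Icc 0 T)))
    atTop (𝓝 0)
  cauchy : Tendsto
    (fun p : ℕ × ℕ => lambdaInner (covFun P X) (φ p.1 - φ p.2) (φ p.1 - φ p.2))
    atTop (𝓝 0)

/-- `Y` is (a version of) the abstract Wiener integral `∫_0^T f(s) dX_s`, the image of `f ∈ Λ`
under the isometry `𝟏_t ↦ X_t` into `L²(Ω)`. The function `f` is required to belong to `Λ`, and `Y`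
has to be the limit for *every* sequence that exhibits `f` as an element of `Λ`, so that `Y` is
determined by `f` up to almost sure equality. -/
structure IsWienerIntegral (P : Measure Ω) (T : ℝ) (X : ℝ → Ω → ℝ) (f : ℝ → ℝ)
    (Y : Ω → ℝ) : Prop where
  memLp_integrand : MemLp f 2 (volume.restrict (Set.Icc 0 T))
  memLp_integral : MemLp Y 2 P
  exists_approx : ∃ φ, IsLambdaApprox P T X f φ
  tendsto : ∀ φ, IsLambdaApprox P T X f φ →
    Tendsto (fun n => eLpNorm (fun ω => stepInt X (φ n) ω - Y ω) 2 P) atTop (𝓝 0)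

/-- `Y` is (a version of) `∫_0^t f(s) dX_s`, i.e. of `∫_0^T f(s) 𝟏_t(s) dX_s`, where
`t ∈ [0,T]`. -/
def IsWienerIntegralUpTo (P : Measure Ω) (T : ℝ) (X : ℝ → Ω → ℝ) (t : ℝ) (f : ℝ → ℝ)
    (Y : Ω → ℝ) : Prop :=
  IsWienerIntegral P T X ((Set.Ico 0 t).indicator f) Y

/-! ### Brownian motion and the completely correlated mixed fBm on `[0,T]` -/

/-- `W` has the finite-dimensional laws of Brownian motion on `[0,T]`. -/
structure IsPreBrownianOn (P : Measure Ω) (T : ℝ) (W : ℝ → Ω → ℝ) : Prop where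
  gaussian : IsGaussianProcess (fun t : Set.Icc (0 : ℝ) T => W t) P
  mean : ∀ t ∈ Set.Icc 0 T, ∫ ω, W t ω ∂P = 0
  covariance : ∀ t ∈ Set.Icc 0 T, ∀ s ∈ Set.Icc 0 T, cov[W t, W s; P] = min t s

/-- `W` is a Brownian motion on `[0,T]`. -/
structure IsBrownianOn (P : Measure Ω) (T : ℝ) (W : ℝ → Ω → ℝ) : Prop
    extends IsPreBrownianOn P T W where
  cont : ∀ᵐ ω ∂P, ContinuousOn (fun t => W t ω) (Set.Icc 0 T)

/-- `X` is the completely correlated mixed fractional Brownian motion on `[0,T]` with parameters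
`a`, `b`, `H`, driven by `W`: `W` is a Brownian motion and `X = a W + b B^H` with
`B^H_t = ∫_0^t K_H(t,s) dW_s`. -/
structure IsCCMFBM (P : Measure Ω) (T a b H : ℝ) (W X : ℝ → Ω → ℝ) : Prop where
  brownian : IsBrownianOn P T W
  eq_mix : ∃ B : ℝ → Ω → ℝ,
    (∀ t ∈ Set.Icc 0 T, IsWienerIntegralUpTo P T W t (fun s => mgKernel H t s) (B t)) ∧
    ∀ t ∈ Set.Icc 0 T, X t =ᵐ[P] fun ω => a * W t ω + b * B t ω

end CCMFBM

end

/-!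
Let `I` be the Wiener integral of `B`, an isometry of `L²[0,T]` into `L²(P)`. An operator `D` with
`D 𝟏_t = L(t,·)` makes `I ∘ D` a continuous extension of `𝟏_t ↦ X_t`, and then `∫ f dX` is
necessarily `I (D f)`. So it suffices to find such a `D` with `D (L⁻¹(t,·)) = 𝟏_t`: this gives
`∫ L⁻¹(t,·) dX = I 𝟏_t = B_t`.

Up to a constant, `K_H(t,·)` is `R 𝟏_t`, where `R f(s) = s^{-α} ∫_s^T u^α f(u) (u-s)^{α-1}/Γ(α) du`
is a weighted fractional integral of order `α = H - 1/2`. Hence `D = a + b c(H) Γ(α) R`. By the Beta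
integral, `R^k` has the kernel of `R` with the exponent `α - 1` replaced by `kα - 1`, so the Neumann
series of `D⁻¹ 𝟏_t` is the series of `L⁻¹(t,·)`; it converges because `Γ(kα)` outgrows every power.
The Schur test with weight `s^{-α}` shows that `R` is bounded on `L²[0,T]`.
-/

noncomputable section

namespace CCMFBM

/-! ### The indicators `𝟏_t` in `L²([0,T])` -/

/-- The Hilbert space `L²([0,T])` of integrands. -/
abbrev L2Icc (T : ℝ) : Type := Lp ℝ 2 (volume.restrict (Set.Icc 0 T))

/-- The class of `𝟏_t` in `L²([0,T])`. -/
def indLp (T t : ℝ) : L2Icc T :=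
  indicatorConstLp 2 (measurableSet_Ico (a := 0) (b := t)) (measure_ne_top _ _) 1

lemma indLp_coeFn (T t : ℝ) : indLp T t =ᵐ[volume.restrict (Set.Icc 0 T)] ind t :=
  indicatorConstLp_coeFn

lemma Ico_subset_Icc_of_mem {T t : ℝ} (ht : t ∈ Set.Icc 0 T) : Set.Ico 0 t ⊆ Set.Icc 0 T :=
  Set.Ico_subset_Icc_self.trans (Set.Icc_subset_Icc_right ht.2)

lemma inner_indLp {T t : ℝ} (ht : t ∈ Set.Icc 0 T) (f : L2Icc T) :
    inner ℝ (indLp T t) f = ∫ s in (0)..t, f s := by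
  rw [indLp, L2.inner_indicatorConstLp_one, Measure.restrict_restrict measurableSet_Ico,
    Set.inter_eq_left.mpr (Ico_subset_Icc_of_mem ht), integral_Ico_eq_integral_Ioc,
    intervalIntegral.integral_of_le ht.1]

lemma inner_indLp_indLp {T t s : ℝ} (ht : t ∈ Set.Icc 0 T) (hs : s ∈ Set.Icc 0 T) :
    inner ℝ (indLp T t) (indLp T s) = min t s := by
  have hsub : Set.Ico 0 (min t s) ⊆ Set.Icc 0 T :=
    Ico_subset_Icc_of_mem ⟨le_min ht.1 hs.1, (min_le_left t s).trans ht.2⟩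
  rw [indLp, indLp, L2.real_inner_indicatorConstLp_one_indicatorConstLp_one, Set.Ico_inter_Ico,
    sup_idem, measureReal_restrict_apply measurableSet_Ico, Set.inter_eq_left.mpr hsub,
    Real.volume_real_Ico_of_le (le_min ht.1 hs.1), sub_zero]

lemma ae_eq_zero_of_forall_intervalIntegral_eq_zero {E : Type*} [NormedAddCommGroup E]
    [NormedSpace ℝ E] [CompleteSpace E] {f : ℝ → E} {a b : ℝ} (hf : IntegrableOn f (Set.Icc a b))
    (hprim : ∀ t ∈ Set.Icc a b, ∫ s in a..t, f s = 0) :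
    f =ᵐ[volume.restrict (Set.Icc a b)] 0 := by
  rw [← restrict_Ioo_eq_restrict_Icc]
  rcases le_or_gt b a with hba | hab
  · simp [Set.Ioo_eq_empty hba.not_gt, EventuallyEq]
  have hderiv := ((intervalIntegrable_iff_integrableOn_Icc_of_le hab.le).mpr
    hf).ae_hasDerivAt_integral
  refine (ae_restrict_iff' measurableSet_Ioo).mpr ?_
  filter_upwards [hderiv] with x hx hxI
  rw [Set.uIcc_of_le hab.le] at hx
  have hzero : (fun t => ∫ s in a..t, f s) =ᶠ[𝓝 x] fun _ => 0 := by
    filter_upwards [Icc_mem_nhds hxI.1 hxI.2] with t ht using hprim t ht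
  exact (hx (Set.Ioo_subset_Icc_self hxI) a (Set.left_mem_Icc.mpr hab.le)).unique
    ((hasDerivAt_const x 0).congr_of_eventuallyEq hzero)

lemma dense_span_indLp (T : ℝ) :
    Dense (Submodule.span ℝ (indLp T '' Set.Icc 0 T) : Set (L2Icc T)) := by
  rw [Submodule.dense_iff_topologicalClosure_eq_top, Submodule.topologicalClosure_eq_top_iff,
    Submodule.eq_bot_iff]
  intro f hf
  refine (Lp.eq_zero_iff_ae_eq_zero).mpr (ae_eq_zero_of_forall_intervalIntegral_eq_zero
    ((Lp.memLp f).integrable one_le_two) fun t ht => ?_)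
  rw [← inner_indLp ht]
  exact hf _ (Submodule.subset_span ⟨t, ht, rfl⟩)

/-! ### Wiener integrals as images under continuous linear maps -/

/-- The step function `∑ c_t 𝟏_t` as an element of `L²([0,T])`. -/
def stepLp (T : ℝ) : (ℝ →₀ ℝ) →ₗ[ℝ] L2Icc T := Finsupp.linearCombination ℝ (indLp T)

lemma coeFn_linearCombination {ι α : Type*} [MeasurableSpace α] {μ : Measure α} {p : ENNReal}
    {v : ι → Lp ℝ p μ} {Z : ι → α → ℝ} {c : ι →₀ ℝ} (hZ : ∀ t ∈ c.support, v t =ᵐ[μ] Z t) :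
    Finsupp.linearCombination ℝ v c =ᵐ[μ] fun x => c.sum fun t y => y * Z t x := by
  have hterm : ∀ᵐ x ∂μ, ∀ t ∈ c.support, (c t • v t : Lp ℝ p μ) x = c t * Z t x := by
    refine (ae_ball_iff c.support.countable_toSet).mpr fun t ht => ?_
    filter_upwards [Lp.coeFn_smul (c t) (v t), hZ t ht] with x hsmul hx
    rw [hsmul, Pi.smul_apply, hx, smul_eq_mul]
  filter_upwards [Lp.coeFn_fun_finsetSum c.support fun t => c t • v t, hterm] with x hsum hx
  rw [Finsupp.linearCombination_apply, Finsupp.sum, hsum]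
  exact Finset.sum_congr rfl hx

lemma stepLp_coeFn (T : ℝ) (c : ℝ →₀ ℝ) :
    stepLp T c =ᵐ[volume.restrict (Set.Icc 0 T)] stepFun c :=
  coeFn_linearCombination fun t _ => indLp_coeFn T t

lemma exists_tendsto_stepLp {T : ℝ} (u : L2Icc T) :
    ∃ φ : ℕ → ℝ →₀ ℝ, (∀ n, φ n ∈ Finsupp.supported ℝ ℝ (Set.Icc 0 T)) ∧
      Tendsto (fun n => stepLp T (φ n)) atTop (𝓝 u) := by
  obtain ⟨x, hx, hxu⟩ := mem_closure_iff_seq_limit.mp (dense_span_indLp T u)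
  choose φ hφ hφx using fun n => (Finsupp.mem_span_image_iff_linearCombination ℝ).mp (hx n)
  exact ⟨φ, hφ, hxu.congr fun n => (hφx n).symm⟩

lemma coeFn_smul_add_smul {α : Type*} [MeasurableSpace α] {μ : Measure α} {p : ENNReal}
    {u v : Lp ℝ p μ} {f g : α → ℝ} (hu : u =ᵐ[μ] f) (hv : v =ᵐ[μ] g) (a b : ℝ) :
    (a • u + b • v : Lp ℝ p μ) =ᵐ[μ] fun x => a * f x + b * g x := by
  filter_upwards [Lp.coeFn_add (a • u) (b • v), Lp.coeFn_smul a u, Lp.coeFn_smul b v, hu, hv]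
    with x hadd hau hbv hux hvx
  rw [hadd, Pi.add_apply, hau, hbv, Pi.smul_apply, Pi.smul_apply, hux, hvx, smul_eq_mul,
    smul_eq_mul]

lemma edist_eq_eLpNorm_of_ae_eq {α : Type*} [MeasurableSpace α] {μ : Measure α} {p : ENNReal}
    {u v : Lp ℝ p μ} {f g : α → ℝ} (hu : u =ᵐ[μ] f) (hv : v =ᵐ[μ] g) :
    edist u v = eLpNorm (fun x => f x - g x) p μ := by
  rw [Lp.edist_def]
  exact eLpNorm_congr_ae (hu.sub hv)

lemma inner_eq_integral_mul {α : Type*} [MeasurableSpace α] {μ : Measure α}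
    {u v : Lp ℝ 2 μ} {f g : α → ℝ} (hu : u =ᵐ[μ] f) (hv : v =ᵐ[μ] g) :
    inner ℝ u v = ∫ x, f x * g x ∂μ := by
  rw [L2.inner_def]
  refine integral_congr_ae ?_
  filter_upwards [hu, hv] with x hux hvx
  rw [hux, hvx, real_inner_comm, RCLike.inner_apply, conj_trivial]

section WienerMap

variable {Ω : Type*} [MeasurableSpace Ω] {P : Measure Ω} {T : ℝ} {Z : ℝ → Ω → ℝ}
  {J : L2Icc T →L[ℝ] Lp ℝ 2 P}

/-- `J` extends `𝟏_t ↦ Z_t` to a bounded operator on `L²([0,T])`. Such an operator, which need not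
be isometric for the norm of `L²([0,T])`, computes all the abstract Wiener integrals of `Z`: see
`IsWienerMap.isWienerIntegral_iff`. -/
def IsWienerMap (P : Measure Ω) (T : ℝ) (Z : ℝ → Ω → ℝ) (J : L2Icc T →L[ℝ] Lp ℝ 2 P) : Prop :=
  ∀ t ∈ Set.Icc 0 T, J (indLp T t) =ᵐ[P] Z t

namespace IsWienerMap

lemma map_stepLp (hJ : IsWienerMap P T Z J) {c : ℝ →₀ ℝ}
    (hc : c ∈ Finsupp.supported ℝ ℝ (Set.Icc 0 T)) : J (stepLp T c) =ᵐ[P] stepInt Z c := by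
  have hmap : J (stepLp T c) = Finsupp.linearCombination ℝ (fun t => J (indLp T t)) c := by
    simp only [stepLp, Finsupp.linearCombination_apply, map_finsuppSum, map_smul]
  rw [hmap]
  exact coeFn_linearCombination fun t ht => hJ t (hc ht)

lemma lambdaInner_covFun (hJ : IsWienerMap P T Z J) {c : ℝ →₀ ℝ}
    (hc : c ∈ Finsupp.supported ℝ ℝ (Set.Icc 0 T)) :
    lambdaInner (covFun P Z) c c = ‖J (stepLp T c)‖ ^ 2 := by
  have hcov : ∀ t ∈ c.support, ∀ s ∈ c.support,
      covFun P Z t s = inner ℝ (J (indLp T t)) (J (indLp T s)) := fun t ht s hs =>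
    (inner_eq_integral_mul (hJ t (hc ht)) (hJ s (hc hs))).symm
  simp only [← real_inner_self_eq_norm_sq, stepLp, Finsupp.linearCombination_apply, Finsupp.sum,
    map_sum, map_smul, sum_inner, inner_sum, lambdaInner]
  rw [Finset.sum_comm]
  refine Finset.sum_congr rfl fun s hs => Finset.sum_congr rfl fun t ht => ?_
  rw [hcov t ht s hs, real_inner_smul_left, real_inner_smul_right, mul_assoc]

lemma isLambdaApprox_iff (hJ : IsWienerMap P T Z J) {u : L2Icc T} {f : ℝ → ℝ}
    (hu : u =ᵐ[volume.restrict (Set.Icc 0 T)] f) {φ : ℕ → ℝ →₀ ℝ} :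
    IsLambdaApprox P T Z f φ ↔ (∀ n, φ n ∈ Finsupp.supported ℝ ℝ (Set.Icc 0 T)) ∧
      Tendsto (fun n => stepLp T (φ n)) atTop (𝓝 u) := by
  have htendsto : Tendsto (fun n => stepLp T (φ n)) atTop (𝓝 u) ↔
      Tendsto (fun n => eLpNorm (fun s => stepFun (φ n) s - f s) 2
        (volume.restrict (Set.Icc 0 T))) atTop (𝓝 0) := by
    simp only [tendsto_iff_edist_tendsto_0, edist_eq_eLpNorm_of_ae_eq (stepLp_coeFn T _) hu]
  refine ⟨fun hφ => ⟨hφ.support_subset, htendsto.mpr hφ.tendsto⟩, fun ⟨hsupp, hlim⟩ =>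
    ⟨hsupp, htendsto.mp hlim, ?_⟩⟩
  have hJlim : Tendsto (fun n => J (stepLp T (φ n))) atTop (𝓝 (J u)) :=
    (J.continuous.tendsto u).comp hlim
  have hnorm := ((hJlim.comp tendsto_fst).sub (hJlim.comp tendsto_snd)).norm.pow 2
  rw [prod_atTop_atTop_eq, sub_self, norm_zero, zero_pow two_ne_zero] at hnorm
  refine hnorm.congr fun p => ?_
  rw [hJ.lambdaInner_covFun (Submodule.sub_mem _ (hsupp p.1) (hsupp p.2)), map_sub, map_sub]
  rfl

theorem isWienerIntegral_iff (hJ : IsWienerMap P T Z J) {u : L2Icc T} {f : ℝ → ℝ}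
    (hu : u =ᵐ[volume.restrict (Set.Icc 0 T)] f) {Y : Ω → ℝ} :
    IsWienerIntegral P T Z f Y ↔ J u =ᵐ[P] Y := by
  have hlim : ∀ φ, IsLambdaApprox P T Z f φ →
      Tendsto (fun n => J (stepLp T (φ n))) atTop (𝓝 (J u)) := fun φ hφ =>
    (J.continuous.tendsto u).comp ((hJ.isLambdaApprox_iff hu).mp hφ).2
  have hedist : ∀ φ, IsLambdaApprox P T Z f φ → ∀ y : Lp ℝ 2 P, y =ᵐ[P] Y → ∀ n,
      edist (J (stepLp T (φ n))) y = eLpNorm (fun ω => stepInt Z (φ n) ω - Y ω) 2 P :=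
    fun φ hφ y hy n => edist_eq_eLpNorm_of_ae_eq (hJ.map_stepLp (hφ.support_subset n)) hy
  constructor
  · intro hY
    obtain ⟨φ, hφ⟩ := hY.exists_approx
    have hYclass := hY.memLp_integral.coeFn_toLp
    have hlimY : Tendsto (fun n => J (stepLp T (φ n))) atTop (𝓝 (hY.memLp_integral.toLp Y)) := by
      simpa only [tendsto_iff_edist_tendsto_0, hedist φ hφ _ hYclass] using hY.tendsto φ hφ
    rwa [tendsto_nhds_unique (hlim φ hφ) hlimY]
  · intro hY
    obtain ⟨φ, hφ⟩ := exists_tendsto_stepLp u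
    refine ⟨(memLp_congr_ae hu).mp (Lp.memLp u), (memLp_congr_ae hY).mp (Lp.memLp (J u)),
      ⟨φ, (hJ.isLambdaApprox_iff hu).mpr hφ⟩, fun ψ hψ => ?_⟩
    simpa only [tendsto_iff_edist_tendsto_0, hedist ψ hψ _ hY] using hlim ψ hψ

lemma isWienerIntegral_ind (hJ : IsWienerMap P T Z J) {t : ℝ} (ht : t ∈ Set.Icc 0 T) :
    IsWienerIntegral P T Z (ind t) (Z t) :=
  (hJ.isWienerIntegral_iff (indLp_coeFn T t)).mpr (hJ t ht)

lemma isWienerIntegral_linearComb (hJ : IsWienerMap P T Z J) {f g : ℝ → ℝ} {Y V : Ω → ℝ}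
    (hf : IsWienerIntegral P T Z f Y) (hg : IsWienerIntegral P T Z g V) (a b : ℝ) :
    IsWienerIntegral P T Z (fun s => a * f s + b * g s) (fun ω => a * Y ω + b * V ω) := by
  have hfu := hf.memLp_integrand.coeFn_toLp
  have hgu := hg.memLp_integrand.coeFn_toLp
  refine (hJ.isWienerIntegral_iff (coeFn_smul_add_smul hfu hgu a b)).mpr ?_
  rw [map_add, map_smul, map_smul]
  exact coeFn_smul_add_smul ((hJ.isWienerIntegral_iff hfu).mp hf)
    ((hJ.isWienerIntegral_iff hgu).mp hg) a b

lemma comp (hJ : IsWienerMap P T Z J) {D : L2Icc T →L[ℝ] L2Icc T} {k : ℝ → ℝ → ℝ}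
    (hD : ∀ t ∈ Set.Icc 0 T, D (indLp T t) =ᵐ[volume.restrict (Set.Icc 0 T)] k t)
    {X : ℝ → Ω → ℝ} (hX : ∀ t ∈ Set.Icc 0 T, IsWienerIntegral P T Z (k t) (X t)) :
    IsWienerMap P T X (J.comp D) := fun t ht =>
  (hJ.isWienerIntegral_iff (hD t ht)).mp (hX t ht)

lemma congr (hJ : IsWienerMap P T Z J) {W : ℝ → Ω → ℝ} (hW : ∀ t ∈ Set.Icc 0 T, W t =ᵐ[P] Z t) :
    IsWienerMap P T W J := fun t ht => (hJ t ht).trans (hW t ht).symm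

end IsWienerMap

end WienerMap

/-! ### The Wiener isometry of a Brownian motion -/

lemma exists_continuousLinearMap_of_inner_eq {ι 𝕜 E F : Type*} [RCLike 𝕜]
    [NormedAddCommGroup E] [InnerProductSpace 𝕜 E] [NormedAddCommGroup F] [InnerProductSpace 𝕜 F]
    [CompleteSpace F] {v : ι → E} {w : ι → F}
    (hgram : ∀ i j, inner 𝕜 (w i) (w j) = inner 𝕜 (v i) (v j))
    (hv : Dense (Submodule.span 𝕜 (Set.range v) : Set E)) :
    ∃ I : E →L[𝕜] F, ∀ i, I (v i) = w i := by
  let e := Finsupp.linearCombination 𝕜 v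
  let g := Finsupp.linearCombination 𝕜 w
  have hnorm : ∀ c, ‖g c‖ = ‖e c‖ := fun c => by
    rw [norm_eq_sqrt_re_inner (𝕜 := 𝕜), norm_eq_sqrt_re_inner (𝕜 := 𝕜)]
    simp only [g, e, Finsupp.linearCombination_apply, Finsupp.sum, sum_inner, inner_sum,
      inner_smul_left, inner_smul_right, hgram]
  have hdense : DenseRange e := by
    rwa [DenseRange, ← LinearMap.coe_range, Finsupp.range_linearCombination]
  refine ⟨g.extendOfNorm e, fun i => ?_⟩
  have hsingle := LinearMap.extendOfNorm_eq hdense ⟨1, fun c => by rw [hnorm c, one_mul]⟩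
    (Finsupp.single i (1 : 𝕜))
  simpa [e, g] using hsingle

section Brownian

variable {Ω : Type*} [MeasurableSpace Ω] {P : Measure Ω} {T : ℝ} {B : ℝ → Ω → ℝ}

lemma exists_isWienerMap_of_covFun_eq_min (hmem : ∀ t ∈ Set.Icc 0 T, MemLp (B t) 2 P)
    (hcov : ∀ t ∈ Set.Icc 0 T, ∀ s ∈ Set.Icc 0 T, covFun P B t s = min t s) :
    ∃ I, IsWienerMap P T B I := by
  let w : Set.Icc 0 T → Lp ℝ 2 P := fun t => (hmem t t.2).toLp (B t)
  have hw : ∀ t : Set.Icc 0 T, w t =ᵐ[P] B t := fun t => (hmem t t.2).coeFn_toLp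
  have hgram : ∀ t s : Set.Icc 0 T, inner ℝ (w t) (w s) = inner ℝ (indLp T t) (indLp T s) :=
    fun t s => by
      rw [inner_eq_integral_mul (hw t) (hw s), inner_indLp_indLp t.2 s.2]
      exact hcov t t.2 s s.2
  obtain ⟨I, hI⟩ := exists_continuousLinearMap_of_inner_eq (𝕜 := ℝ) hgram (by
    simpa only [Set.image_eq_range] using dense_span_indLp T)
  exact ⟨I, fun t ht => by rw [hI ⟨t, ht⟩]; exact hw ⟨t, ht⟩⟩

namespace IsPreBrownianOn

theorem exists_isWienerMap [IsProbabilityMeasure P] (hB : IsPreBrownianOn P T B) :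
    ∃ I, IsWienerMap P T B I := by
  have hmem : ∀ t ∈ Set.Icc 0 T, MemLp (B t) 2 P := fun t ht =>
    (hB.gaussian.hasGaussianLaw_eval ⟨t, ht⟩).memLp ENNReal.ofNat_ne_top
  refine exists_isWienerMap_of_covFun_eq_min hmem fun t ht s hs => ?_
  rw [← hB.covariance t ht s hs, covariance_eq_sub (hmem t ht) (hmem s hs), hB.mean t ht,
    zero_mul, sub_zero]
  rfl

lemma congr (hB : IsPreBrownianOn P T B) {W : ℝ → Ω → ℝ}
    (hW : ∀ t ∈ Set.Icc 0 T, W t =ᵐ[P] B t) : IsPreBrownianOn P T W where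
  gaussian := hB.gaussian.congr fun t => (hW t t.2).symm
  mean t ht := (integral_congr_ae (hW t ht)).trans (hB.mean t ht)
  covariance t ht s hs := by
    rw [← hB.covariance t ht s hs, ProbabilityTheory.covariance, ProbabilityTheory.covariance,
      integral_congr_ae (hW t ht), integral_congr_ae (hW s hs)]
    refine integral_congr_ae ?_
    filter_upwards [hW t ht, hW s hs] with ω hWt hWs
    rw [hWt, hWs]

end IsPreBrownianOn

end Brownian

/-! ### Beta integrals and the Mittag-Leffler series -/

lemma lintegral_Ioo_sub_rpow_mul_sub_rpow {p q s v : ℝ} (hp : 0 < p) (hq : 0 < q) (hsv : s < v) :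
    ∫⁻ u in Set.Ioo s v, ‖(u - s) ^ (p - 1) * (v - u) ^ (q - 1)‖ₑ
      = ‖(v - s) ^ (p + q - 1) * beta p q‖ₑ := by
  have hl : 0 < v - s := sub_pos.mpr hsv
  have hbeta : 0 < beta p q := beta_pos hp hq
  have himage : Set.Ioo s v = (fun x => (v - s) * x + s) '' Set.Ioo 0 1 := by
    rw [Set.image_affine_Ioo hl, mul_zero, zero_add, mul_one, sub_add_cancel]
  have hscale : ∀ x ∈ Set.Ioo (0 : ℝ) 1, ENNReal.ofReal |v - s|
      * ‖((v - s) * x + s - s) ^ (p - 1) * (v - ((v - s) * x + s)) ^ (q - 1)‖ₑ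
      = ‖(v - s) ^ (p + q - 1) * beta p q‖ₑ
        * ENNReal.ofReal (1 / beta p q * x ^ (p - 1) * (1 - x) ^ (q - 1)) := by
    intro x hx
    have hx' : 0 < 1 - x := sub_pos.mpr hx.2
    have hx0 := hx.1
    rw [← Real.enorm_eq_ofReal_abs, ← Real.enorm_of_nonneg (by positivity), ← enorm_mul,
      ← enorm_mul, add_sub_cancel_right, show v - ((v - s) * x + s) = (v - s) * (1 - x) by ring,
      Real.mul_rpow hl.le hx0.le, Real.mul_rpow hl.le hx'.le,
      show p + q - 1 = 1 + (p - 1) + (q - 1) by ring, Real.rpow_add hl, Real.rpow_add hl,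
      Real.rpow_one]
    congr 1
    field_simp
  rw [himage, lintegral_image_eq_lintegral_abs_deriv_mul measurableSet_Ioo
    (fun x _ => (((hasDerivAt_id' x).const_mul (v - s)).add_const s).hasDerivWithinAt)
    (fun x _ y _ hxy => by simpa [hl.ne'] using hxy)]
  simp only [mul_one]
  rw [setLIntegral_congr_fun measurableSet_Ioo hscale, lintegral_const_mul' _ _ enorm_ne_top,
    ← lintegral_betaPDF, lintegral_betaPDF_eq_one hp hq, mul_one]

lemma rpow_mul_exp_neg_le_Gamma {y R : ℝ} (hy : 0 ≤ y) (hR : 0 ≤ R) :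
    R ^ y * Real.exp (-R) ≤ Real.Gamma (y + 1) := by
  have hconv := Real.GammaIntegral_convergent (s := y + 1) (by linarith)
  have hsub : Set.Ioi R ⊆ Set.Ioi 0 := Set.Ioi_subset_Ioi hR
  calc R ^ y * Real.exp (-R) = ∫ x in Set.Ioi R, R ^ y * Real.exp (-x) := by
        rw [integral_const_mul, integral_exp_neg_Ioi]
    _ ≤ ∫ x in Set.Ioi R, Real.exp (-x) * x ^ (y + 1 - 1) := by
        refine setIntegral_mono_on ((integrableOn_exp_neg_Ioi R).const_mul _)
          (hconv.mono_set hsub) measurableSet_Ioi fun x hx => ?_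
        rw [mul_comm, add_sub_cancel_right]
        gcongr
        exact le_of_lt hx
    _ ≤ ∫ x in Set.Ioi 0, Real.exp (-x) * x ^ (y + 1 - 1) := by
        refine setIntegral_mono_set hconv ?_ hsub.eventuallyLE
        filter_upwards [ae_restrict_mem measurableSet_Ioi] with x hx
        exact mul_nonneg (Real.exp_nonneg _) (Real.rpow_nonneg (le_of_lt hx) _)
    _ = Real.Gamma (y + 1) := (Real.Gamma_eq_integral (by linarith)).symm

-- For `R = (2|M| + 2)^{1/α}` the bound `Γ(kα + 1) ≥ R^{kα} e^{-R}` leaves a geometric series.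
theorem summable_pow_div_Gamma {α : ℝ} (hα : 0 < α) (M : ℝ) :
    Summable fun k : ℕ => M ^ k / Real.Gamma (k * α + 1) := by
  set N := 2 * (|M| + 1)
  have hN0 : 0 < N := by positivity
  set R := N ^ α⁻¹
  have hR0 : 0 < R := Real.rpow_pos_of_pos hN0 _
  have hRpow : ∀ k : ℕ, R ^ (k * α) = N ^ k := fun k => by
    rw [mul_comm, Real.rpow_mul hR0.le, Real.rpow_inv_rpow hN0.le hα.ne', Real.rpow_natCast]
  refine Summable.of_norm_bounded (summable_geometric_two.mul_left (Real.exp R)) fun k => ?_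
  have hGamma := rpow_mul_exp_neg_le_Gamma (y := k * α) (by positivity) hR0.le
  have hGamma0 : 0 < Real.Gamma (k * α + 1) := Real.Gamma_pos_of_pos (by positivity)
  rw [norm_div, norm_pow, Real.norm_eq_abs, Real.norm_of_nonneg hGamma0.le, div_le_iff₀ hGamma0]
  calc |M| ^ k ≤ ((1 / 2) * N) ^ k := by gcongr; linarith
    _ = Real.exp R * (1 / 2) ^ k * (R ^ (k * α) * Real.exp (-R)) := by
        rw [hRpow, Real.exp_neg, mul_pow]
        field_simp
    _ ≤ Real.exp R * (1 / 2) ^ k * Real.Gamma (k * α + 1) := by gcongr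

/-! ### Weighted fractional integration kernels -/

/-- The kernel `s^{-α} u^α (u-s)^{p-1} / Γ(p)`, `0 < s < u`, of the right-sided Riemann–Liouville
integral of order `p`, conjugated by the power `α`. -/
def fracKernel (α p s u : ℝ) : ℝ :=
  if 0 < s ∧ s < u then (Real.Gamma p)⁻¹ * (s ^ α)⁻¹ * (u ^ α * (u - s) ^ (p - 1)) else 0

section FracKernel

variable {α p q s t u v T : ℝ}

lemma fracKernel_of_lt (hs : 0 < s) (hu : s < u) :
    fracKernel α p s u = (Real.Gamma p)⁻¹ * (s ^ α)⁻¹ * (u ^ α * (u - s) ^ (p - 1)) :=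
  if_pos ⟨hs, hu⟩

lemma fracKernel_of_nonpos (hs : s ≤ 0) : fracKernel α p s u = 0 :=
  if_neg fun h => h.1.not_ge hs

lemma fracKernel_of_le (hu : u ≤ s) : fracKernel α p s u = 0 :=
  if_neg fun h => h.2.not_ge hu

lemma fracKernel_nonneg (hp : 0 < p) (s u : ℝ) : 0 ≤ fracKernel α p s u := by
  unfold fracKernel
  split_ifs with h
  · have hu := h.1.trans h.2
    have hus := sub_pos.mpr h.2
    have hs := h.1
    positivity
  · rfl

lemma measurable_fracKernel (α p : ℝ) : Measurable (Function.uncurry (fracKernel α p)) :=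
  Measurable.ite ((measurableSet_lt measurable_const measurable_fst).inter
    (measurableSet_lt measurable_fst measurable_snd)) (by fun_prop) measurable_const

lemma measurable_fracKernel_right (α p s : ℝ) : Measurable (fracKernel α p s) :=
  (measurable_fracKernel α p).comp measurable_prodMk_left

lemma fracKernel_mul_fracKernel (hs : 0 < s) (u : ℝ) :
    fracKernel α p s u * fracKernel α q u v
      = (Set.Ioo s v).indicator (fun u => (Real.Gamma p)⁻¹ * (Real.Gamma q)⁻¹ * (s ^ α)⁻¹ * v ^ α
        * ((u - s) ^ (p - 1) * (v - u) ^ (q - 1))) u := by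
  by_cases hsu : s < u
  · by_cases huv : u < v
    · have hu : 0 < u := hs.trans hsu
      rw [Set.indicator_of_mem (show u ∈ Set.Ioo s v from ⟨hsu, huv⟩), fracKernel_of_lt hs hsu,
        fracKernel_of_lt hu huv]
      field_simp
    · rw [fracKernel_of_le (not_lt.mp huv), Set.indicator_of_notMem fun h => huv h.2, mul_zero]
  · rw [fracKernel_of_le (not_lt.mp hsu), Set.indicator_of_notMem fun h => hsu h.1, zero_mul]

theorem lintegral_fracKernel_mul_fracKernel (hp : 0 < p) (hq : 0 < q) (s v : ℝ) :
    ∫⁻ u, ‖fracKernel α p s u‖ₑ * ‖fracKernel α q u v‖ₑ = ‖fracKernel α (p + q) s v‖ₑ := by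
  rcases le_or_gt s 0 with hs | hs
  · simp [fracKernel_of_nonpos hs]
  simp only [← enorm_mul, fracKernel_mul_fracKernel hs, enorm_indicator_eq_indicator_enorm]
  rw [lintegral_indicator measurableSet_Ioo]
  rcases le_or_gt v s with hvs | hsv
  · simp [fracKernel_of_le hvs, Set.Ioo_eq_empty hvs.not_gt]
  simp only [enorm_mul _ (_ * _ : ℝ)]
  rw [lintegral_const_mul' _ _ enorm_ne_top, lintegral_Ioo_sub_rpow_mul_sub_rpow hp hq hsv,
    ← enorm_mul, fracKernel_of_lt hs hsv, beta]
  congr 1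
  field_simp

-- On `u < v` the weight `u^{-α}` is `v^{-α} fracKernel α 1 u v`, so this is the semigroup property.
lemma lintegral_Iio_fracKernel_mul_weight_le (hp : 0 < p) (s v : ℝ) :
    ∫⁻ u in Set.Iio v, ‖fracKernel α p s u‖ₑ * ‖(u ^ α)⁻¹‖ₑ
      ≤ ‖v ^ p / Real.Gamma (p + 1)‖ₑ * ‖(s ^ α)⁻¹‖ₑ := by
  rcases le_or_gt s 0 with hs | hs
  · simp [fracKernel_of_nonpos hs]
  have hweight : ∀ u ∈ Set.Iio v, ‖fracKernel α p s u‖ₑ * ‖(u ^ α)⁻¹‖ₑ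
      = ‖(v ^ α)⁻¹‖ₑ * (‖fracKernel α p s u‖ₑ * ‖fracKernel α 1 u v‖ₑ) := by
    intro u huv
    rcases le_or_gt u s with hus | hsu
    · simp [fracKernel_of_le hus]
    have hu : 0 < u := hs.trans hsu
    have hv : 0 < v := hu.trans huv
    rw [fracKernel_of_lt hu huv, mul_left_comm, ← enorm_mul (v ^ α)⁻¹]
    congr 2
    simp [field]
  rw [setLIntegral_congr_fun measurableSet_Iio hweight, lintegral_const_mul' _ _ enorm_ne_top]
  refine (mul_le_mul_right (setLIntegral_le_lintegral _ _) _).trans ?_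
  rw [lintegral_fracKernel_mul_fracKernel hp one_pos, ← enorm_mul, ← enorm_mul]
  rcases le_or_gt v s with hvs | hsv
  · simp [fracKernel_of_le hvs]
  have hv : 0 < v := hs.trans hsv
  have hvs : 0 ≤ v - s := sub_nonneg.mpr hsv.le
  have hpow : (v - s) ^ p ≤ v ^ p := Real.rpow_le_rpow hvs (by linarith) hp.le
  rw [fracKernel_of_lt hs hsv, add_sub_cancel_right, Real.enorm_of_nonneg (by positivity),
    Real.enorm_of_nonneg (by positivity)]
  refine ENNReal.ofReal_le_ofReal ?_
  calc (v ^ α)⁻¹ * ((Real.Gamma (p + 1))⁻¹ * (s ^ α)⁻¹ * (v ^ α * (v - s) ^ p))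
      = (v - s) ^ p / Real.Gamma (p + 1) * (s ^ α)⁻¹ := by field_simp
    _ ≤ v ^ p / Real.Gamma (p + 1) * (s ^ α)⁻¹ := by gcongr

lemma lintegral_weight_mul_fracKernel (hp : 0 < p) (hα : α < 1 / 2) (hu : 0 < u) :
    ∫⁻ s, ‖fracKernel α p s u‖ₑ * ‖(s ^ α)⁻¹‖ₑ
      = ‖u ^ p * (Real.Gamma (1 - 2 * α) / Real.Gamma (1 - 2 * α + p))‖ₑ * ‖(u ^ α)⁻¹‖ₑ := by
  have hker : ∀ s, fracKernel α p s u * (s ^ α)⁻¹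
      = (Set.Ioo 0 u).indicator (fun s => (Real.Gamma p)⁻¹ * u ^ α
        * ((s - 0) ^ (1 - 2 * α - 1) * (u - s) ^ (p - 1))) s := by
    intro s
    by_cases hs : s ∈ Set.Ioo 0 u
    · rw [Set.indicator_of_mem hs, fracKernel_of_lt hs.1 hs.2, sub_zero,
        show 1 - 2 * α - 1 = -α + -α by ring, Real.rpow_add hs.1, Real.rpow_neg hs.1.le]
      ring
    · rw [Set.indicator_of_notMem hs, fracKernel, if_neg (show ¬(0 < s ∧ s < u) from hs),
        zero_mul]
  simp only [← enorm_mul, hker, enorm_indicator_eq_indicator_enorm]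
  rw [lintegral_indicator measurableSet_Ioo]
  simp only [enorm_mul _ (_ * _ : ℝ)]
  rw [lintegral_const_mul' _ _ enorm_ne_top,
    lintegral_Ioo_sub_rpow_mul_sub_rpow (by linarith) hp hu, ← enorm_mul, sub_zero, beta,
    show 1 - 2 * α + p - 1 = p + -α + -α by ring, Real.rpow_add hu, Real.rpow_add hu,
    Real.rpow_neg hu.le]
  congr 1
  field_simp

lemma lintegral_Iio_fracKernel_le (hα : 0 ≤ α) (hp : 0 < p) (s t : ℝ) :
    ∫⁻ u in Set.Iio t, ‖fracKernel α p s u‖ₑ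
      ≤ ‖t ^ α * (t ^ p / Real.Gamma (p + 1)) * (s ^ α)⁻¹‖ₑ := by
  have hweight : ∀ u ∈ Set.Iio t, ‖fracKernel α p s u‖ₑ
      ≤ ‖t ^ α‖ₑ * (‖fracKernel α p s u‖ₑ * ‖(u ^ α)⁻¹‖ₑ) := by
    intro u hut
    by_cases h : 0 < s ∧ s < u
    · have hu : 0 < u := h.1.trans h.2
      have hone : 1 ≤ t ^ α * (u ^ α)⁻¹ := by
        rw [← div_eq_mul_inv, one_le_div (by positivity)]
        exact Real.rpow_le_rpow hu.le (le_of_lt hut) hα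
      rw [mul_left_comm, ← enorm_mul (t ^ α), Real.enorm_of_nonneg (zero_le_one.trans hone)]
      exact le_mul_of_one_le_right' (ENNReal.one_le_ofReal.mpr hone)
    · simp [fracKernel, h]
  refine (setLIntegral_mono' measurableSet_Iio hweight).trans ?_
  rw [lintegral_const_mul' _ _ enorm_ne_top, mul_assoc (t ^ α), enorm_mul, enorm_mul]
  gcongr
  exact lintegral_Iio_fracKernel_mul_weight_le hp s t

/-- The weighted fractional integral of order `p` of `𝟏_t`. -/
def fracPrim (α p t s : ℝ) : ℝ := ∫ u in Set.Iio t, fracKernel α p s u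

lemma fracPrim_nonneg (hp : 0 < p) (t s : ℝ) : 0 ≤ fracPrim α p t s :=
  integral_nonneg fun u => fracKernel_nonneg hp s u

lemma measurable_fracPrim (α p t : ℝ) : Measurable (fracPrim α p t) :=
  (measurable_fracKernel α p).stronglyMeasurable.integral_prod_right.measurable

lemma fracPrim_eq_zero (h : ¬ (0 < s ∧ s < t)) : fracPrim α p t s = 0 :=
  setIntegral_eq_zero_of_forall_eq_zero fun _ hu =>
    if_neg fun hsu => h ⟨hsu.1, hsu.2.trans hu⟩

lemma enorm_fracPrim (hα : 0 ≤ α) (hp : 0 < p) (t s : ℝ) :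
    ‖fracPrim α p t s‖ₑ = ∫⁻ u in Set.Iio t, ‖fracKernel α p s u‖ₑ := by
  have hint : IntegrableOn (fracKernel α p s) (Set.Iio t) :=
    ⟨(measurable_fracKernel_right α p s).aestronglyMeasurable,
      (lintegral_Iio_fracKernel_le hα hp s t).trans_lt enorm_lt_top⟩
  rw [← ofReal_integral_norm_eq_lintegral_enorm hint, Real.enorm_of_nonneg (fracPrim_nonneg hp t s)]
  simp only [Real.norm_of_nonneg (fracKernel_nonneg hp s _), fracPrim]

lemma abs_fracPrim_le (hα : 0 ≤ α) (hp : 0 < p) (ht : 0 ≤ t) (hs : 0 ≤ s) :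
    |fracPrim α p t s| ≤ t ^ α * (t ^ p / Real.Gamma (p + 1)) * (s ^ α)⁻¹ := by
  rw [← Real.norm_eq_abs, ← abs_of_nonneg (a := _ * _ * _) (by positivity), ← Real.norm_eq_abs,
    ← enorm_le_iff_norm_le, enorm_fracPrim hα hp]
  exact lintegral_Iio_fracKernel_le hα hp s t

lemma fracPrim_eq_intervalIntegral (hs : 0 < s) (hst : s < t) :
    fracPrim α p t s
      = (Real.Gamma p)⁻¹ * (s ^ α)⁻¹ * ∫ u in s..t, u ^ α * (u - s) ^ (p - 1) := by
  have hzero : ∀ u ∈ Set.Iio t \ Set.Ioo s t, fracKernel α p s u = 0 := fun u hu =>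
    fracKernel_of_le (not_lt.mp fun hsu => hu.2 ⟨hsu, hu.1⟩)
  rw [fracPrim, setIntegral_eq_of_subset_of_forall_sdiff_eq_zero measurableSet_Iio
      Set.Ioo_subset_Iio_self hzero,
    setIntegral_congr_fun measurableSet_Ioo fun u hu => fracKernel_of_lt hs hu.1,
    integral_const_mul, intervalIntegral.integral_of_le hst.le, integral_Ioc_eq_integral_Ioo]

theorem integral_fracKernel_mul_ind (htT : t ≤ T) (s : ℝ) :
    ∫ u in Set.Icc 0 T, fracKernel α p s u * ind t u = fracPrim α p t s := by
  rw [fracPrim, ← integral_indicator measurableSet_Icc, ← integral_indicator measurableSet_Iio]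
  congr 1 with u
  by_cases hsu : 0 < s ∧ s < u
  · have hu : 0 < u := hsu.1.trans hsu.2
    by_cases hut : u < t
    · simp [ind, Set.indicator, hu.le, hut, hut.le.trans htT]
    · simp [ind, Set.indicator, hut]
  · simp [fracKernel, hsu, Set.indicator]

theorem integral_fracKernel_mul_fracPrim (hα : 0 ≤ α) (hp : 0 < p) (hq : 0 < q) (htT : t ≤ T)
    (s : ℝ) :
    ∫ u in Set.Icc 0 T, fracKernel α p s u * fracPrim α q t u = fracPrim α (p + q) t s := by
  have hnonneg : ∀ u, 0 ≤ fracKernel α p s u * fracPrim α q t u := fun u =>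
    mul_nonneg (fracKernel_nonneg hp s u) (fracPrim_nonneg hq t u)
  have hmeas_prod : Measurable fun u => fracKernel α p s u * fracPrim α q t u :=
    (measurable_fracKernel_right α p s).mul (measurable_fracPrim α q t)
  have hmeas : Measurable (Function.uncurry fun u v =>
      ‖fracKernel α p s u‖ₑ * ‖fracKernel α q u v‖ₑ) :=
    ((measurable_fracKernel_right α p s).comp measurable_fst).enorm.mul
      (measurable_fracKernel α q).enorm
  have hzero : ∀ u ∉ Set.Icc 0 T, fracKernel α p s u * fracPrim α q t u = 0 := fun u hu => by
    rw [fracPrim_eq_zero fun h => hu ⟨h.1.le, h.2.le.trans htT⟩, mul_zero]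
  rw [setIntegral_eq_integral_of_forall_compl_eq_zero hzero,
    ← Real.norm_of_nonneg (fracPrim_nonneg (add_pos hp hq) t s), ← toReal_enorm,
    enorm_fracPrim hα (add_pos hp hq)]
  calc ∫ u, fracKernel α p s u * fracPrim α q t u
      = ∫ u, ‖fracKernel α p s u * fracPrim α q t u‖ := by
        simp only [Real.norm_of_nonneg (hnonneg _)]
    _ = (∫⁻ u, ‖fracKernel α p s u‖ₑ * ∫⁻ v in Set.Iio t, ‖fracKernel α q u v‖ₑ).toReal := by
        rw [integral_norm_eq_lintegral_enorm hmeas_prod.aestronglyMeasurable]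
        simp only [enorm_mul, enorm_fracPrim hα hq]
    _ = (∫⁻ v in Set.Iio t, ∫⁻ u, ‖fracKernel α p s u‖ₑ * ‖fracKernel α q u v‖ₑ).toReal := by
        simp only [← lintegral_const_mul' _ _ enorm_ne_top]
        rw [lintegral_lintegral_swap hmeas.aemeasurable]
    _ = (∫⁻ v in Set.Iio t, ‖fracKernel α (p + q) s v‖ₑ).toReal := by
        simp only [lintegral_fracKernel_mul_fracKernel hp hq]

end FracKernel

/-! ### Integral operators on `L²` and the Schur test -/

section IntegralOperator

open scoped ENNReal NNReal

variable {α β : Type*} [MeasurableSpace α] [MeasurableSpace β] {μ : Measure α} {ν : Measure β}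

lemma eLpNorm_two_sq {ε : Type*} [ENorm ε] (f : α → ε) :
    eLpNorm f 2 μ ^ 2 = ∫⁻ x, ‖f x‖ₑ ^ 2 ∂μ := by
  simpa only [NNReal.coe_two, ENNReal.rpow_two, ENNReal.coe_ofNat] using
    eLpNorm_nnreal_pow_eq_lintegral (f := f) (μ := μ) (two_ne_zero (α := ℝ≥0))

lemma sq_lintegral_mul_le {f g : α → ℝ≥0∞} (hf : AEMeasurable f μ) (hg : AEMeasurable g μ) :
    (∫⁻ x, f x * g x ∂μ) ^ 2 ≤ (∫⁻ x, f x ^ 2 ∂μ) * ∫⁻ x, g x ^ 2 ∂μ := by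
  have hholder := ENNReal.lintegral_mul_le_Lp_mul_Lq μ Real.HolderConjugate.two_two hf hg
  simp only [Pi.mul_apply, ENNReal.rpow_two] at hholder
  refine (pow_le_pow_left₀ zero_le hholder 2).trans_eq ?_
  simp only [mul_pow, ← ENNReal.rpow_mul_natCast]
  norm_num

lemma sq_lintegral_mul_le_of_weight {k f w : α → ℝ≥0∞} (hk : AEMeasurable k μ)
    (hf : AEMeasurable f μ) (hw : AEMeasurable w μ) (hw0 : ∀ᵐ x ∂μ, w x ≠ 0)
    (hw_top : ∀ᵐ x ∂μ, w x ≠ ∞) :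
    (∫⁻ x, k x * f x ∂μ) ^ 2
      ≤ (∫⁻ x, k x * w x ∂μ) * ∫⁻ x, k x * (f x ^ 2 * (w x)⁻¹) ∂μ := by
  have hsq : ∀ z : ℝ≥0∞, (z ^ (1 / 2 : ℝ)) ^ 2 = z := fun z => by
    rw [← ENNReal.rpow_mul_natCast]
    norm_num
  have hfactor : ∫⁻ x, k x * f x ∂μ
      = ∫⁻ x, (k x * w x) ^ (1 / 2 : ℝ) * (k x * (f x ^ 2 * (w x)⁻¹)) ^ (1 / 2 : ℝ) ∂μ := by
    refine lintegral_congr_ae ?_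
    filter_upwards [hw0, hw_top] with x hx0 hx_top
    refine (ENNReal.pow_right_strictMono two_ne_zero).injective ?_
    calc (k x * f x) ^ 2 = (k x * f x) ^ 2 * (w x * (w x)⁻¹) := by
          rw [ENNReal.mul_inv_cancel hx0 hx_top, mul_one]
      _ = k x * w x * (k x * (f x ^ 2 * (w x)⁻¹)) := by ring
      _ = _ := by rw [mul_pow, hsq, hsq]
  rw [hfactor]
  refine (sq_lintegral_mul_le (by fun_prop) (by fun_prop)).trans_eq ?_
  simp only [hsq]

theorem lintegral_sq_lintegral_mul_le_of_schur [SFinite μ] [SFinite ν] {k : α → β → ℝ≥0∞}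
    (hk : Measurable (Function.uncurry k)) {v : α → ℝ≥0∞} {w : β → ℝ≥0∞} (hv : Measurable v)
    (hw : Measurable w) (hw0 : ∀ᵐ y ∂ν, w y ≠ 0) (hw_top : ∀ᵐ y ∂ν, w y ≠ ∞) {C₁ C₂ : ℝ≥0∞}
    (hrow : ∀ᵐ x ∂μ, ∫⁻ y, k x y * w y ∂ν ≤ C₁ * v x)
    (hcol : ∀ᵐ y ∂ν, ∫⁻ x, k x y * v x ∂μ ≤ C₂ * w y) {f : β → ℝ≥0∞} (hf : Measurable f) :
    ∫⁻ x, (∫⁻ y, k x y * f y ∂ν) ^ 2 ∂μ ≤ C₁ * C₂ * ∫⁻ y, f y ^ 2 ∂ν := by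
  have hkx : ∀ x, Measurable (k x) := fun x => hk.comp measurable_prodMk_left
  have hky : ∀ y, Measurable fun x => k x y := fun y => hk.comp measurable_prodMk_right
  let g : β → ℝ≥0∞ := fun y => f y ^ 2 * (w y)⁻¹
  have hg : Measurable g := (hf.pow_const 2).mul hw.inv
  have hprod : Measurable (Function.uncurry fun x y => v x * (k x y * g y)) :=
    (hv.comp measurable_fst).mul (hk.mul (hg.comp measurable_snd))
  have hcauchy : ∀ᵐ x ∂μ, (∫⁻ y, k x y * f y ∂ν) ^ 2 ≤ C₁ * ∫⁻ y, v x * (k x y * g y) ∂ν := by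
    filter_upwards [hrow] with x hx
    have hmeas : Measurable fun y => k x y * g y := (hkx x).mul hg
    rw [lintegral_const_mul _ hmeas, ← mul_assoc]
    exact (sq_lintegral_mul_le_of_weight (hkx x).aemeasurable hf.aemeasurable hw.aemeasurable
      hw0 hw_top).trans (mul_le_mul_left hx _)
  have hcol' : ∀ᵐ y ∂ν, ∫⁻ x, v x * (k x y * g y) ∂μ ≤ C₂ * f y ^ 2 := by
    filter_upwards [hcol, hw0, hw_top] with y hy hy0 hy_top
    calc ∫⁻ x, v x * (k x y * g y) ∂μ = ∫⁻ x, g y * (k x y * v x) ∂μ := by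
          simp only [mul_comm (g y), mul_assoc, mul_left_comm (v _)]
      _ = g y * ∫⁻ x, k x y * v x ∂μ := lintegral_const_mul _ ((hky y).mul hv)
      _ ≤ g y * (C₂ * w y) := by gcongr
      _ = C₂ * f y ^ 2 * (w y * (w y)⁻¹) := by ring
      _ = C₂ * f y ^ 2 := by rw [ENNReal.mul_inv_cancel hy0 hy_top, mul_one]
  calc ∫⁻ x, (∫⁻ y, k x y * f y ∂ν) ^ 2 ∂μ
      ≤ ∫⁻ x, C₁ * ∫⁻ y, v x * (k x y * g y) ∂ν ∂μ := lintegral_mono_ae hcauchy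
    _ = C₁ * ∫⁻ y, ∫⁻ x, v x * (k x y * g y) ∂μ ∂ν := by
        rw [lintegral_const_mul _ hprod.lintegral_prod_right,
          lintegral_lintegral_swap hprod.aemeasurable]
    _ ≤ C₁ * ∫⁻ y, C₂ * f y ^ 2 ∂ν := by gcongr C₁ * ?_; exact lintegral_mono_ae hcol'
    _ = C₁ * C₂ * ∫⁻ y, f y ^ 2 ∂ν := by rw [lintegral_const_mul _ (hf.pow_const 2), mul_assoc]

/-- The integral operator with kernel `|k|` is bounded from `L²(ν)` to `L²(μ)`, with norm at most
`C`. -/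
structure IsBoundedKernel (k : α → β → ℝ) (C : ℝ≥0) (μ : Measure α) (ν : Measure β) : Prop where
  measurable : Measurable (Function.uncurry k)
  eLpNorm_le : ∀ f : β → ℝ≥0∞, Measurable f →
    eLpNorm (fun x => ∫⁻ y, ‖k x y‖ₑ * f y ∂ν) 2 μ ≤ C * eLpNorm f 2 ν

/-- `A` is the integral operator with kernel `k` from `L²(ν)` to `L²(μ)`. -/
def IsIntegralOperator (k : α → β → ℝ) (A : Lp ℝ 2 ν →L[ℝ] Lp ℝ 2 μ) : Prop :=
  ∀ f : Lp ℝ 2 ν, A f =ᵐ[μ] fun x => ∫ y, k x y * f y ∂ν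

lemma IsIntegralOperator.apply_ae_eq {k : α → β → ℝ} {A : Lp ℝ 2 ν →L[ℝ] Lp ℝ 2 μ}
    (hA : IsIntegralOperator k A) {u : Lp ℝ 2 ν} {f : β → ℝ} (hu : u =ᵐ[ν] f) :
    A u =ᵐ[μ] fun x => ∫ y, k x y * f y ∂ν := by
  filter_upwards [hA u] with x hx
  rw [hx]
  refine integral_congr_ae ?_
  filter_upwards [hu] with y hy
  rw [hy]

namespace IsBoundedKernel

variable {k : α → β → ℝ} {C : ℝ≥0}

lemma of_schur [SFinite μ] [SFinite ν] (hk : Measurable (Function.uncurry k)) {v : α → ℝ≥0∞}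
    {w : β → ℝ≥0∞} (hv : Measurable v) (hw : Measurable w) (hw0 : ∀ᵐ y ∂ν, w y ≠ 0)
    (hw_top : ∀ᵐ y ∂ν, w y ≠ ∞) {C₁ C₂ : ℝ≥0}
    (hrow : ∀ᵐ x ∂μ, ∫⁻ y, ‖k x y‖ₑ * w y ∂ν ≤ C₁ * v x)
    (hcol : ∀ᵐ y ∂ν, ∫⁻ x, ‖k x y‖ₑ * v x ∂μ ≤ C₂ * w y) :
    IsBoundedKernel k (NNReal.sqrt (C₁ * C₂)) μ ν where
  measurable := hk
  eLpNorm_le f hf := by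
    rw [← ENNReal.pow_le_pow_left_iff two_ne_zero, mul_pow, eLpNorm_two_sq, eLpNorm_two_sq,
      ← ENNReal.coe_pow, NNReal.sq_sqrt, ENNReal.coe_mul]
    exact lintegral_sq_lintegral_mul_le_of_schur hk.enorm hv hw hw0 hw_top hrow hcol hf

lemma eLpNorm_lintegral_le (hk : IsBoundedKernel k C μ ν) (f : Lp ℝ 2 ν) :
    eLpNorm (fun x => ∫⁻ y, ‖k x y * f y‖ₑ ∂ν) 2 μ ≤ C * ‖f‖ₑ := by
  simpa only [enorm_mul, eLpNorm_enorm, ← Lp.enorm_def] using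
    hk.eLpNorm_le _ (Lp.stronglyMeasurable f).measurable.enorm

lemma measurable_mul (hk : IsBoundedKernel k C μ ν) (f : Lp ℝ 2 ν) :
    Measurable (Function.uncurry fun x y => k x y * f y) :=
  hk.measurable.mul ((Lp.stronglyMeasurable f).measurable.comp measurable_snd)

lemma ae_integrable [SFinite ν] (hk : IsBoundedKernel k C μ ν) (f : Lp ℝ 2 ν) :
    ∀ᵐ x ∂μ, Integrable (fun y => k x y * f y) ν := by
  have hmeas : Measurable fun x => ∫⁻ y, ‖k x y * f y‖ₑ ∂ν :=
    (hk.measurable_mul f).enorm.lintegral_prod_right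
  have hfin : ∫⁻ x, (∫⁻ y, ‖k x y * f y‖ₑ ∂ν) ^ 2 ∂μ ≠ ∞ := by
    refine (eLpNorm_two_sq (μ := μ) fun x => ∫⁻ y, ‖k x y * f y‖ₑ ∂ν).symm.trans_ne ?_
    exact ENNReal.pow_ne_top (ne_top_of_le_ne_top (by finiteness) (hk.eLpNorm_lintegral_le f))
  filter_upwards [ae_lt_top (hmeas.pow_const 2) hfin] with x hx
  exact ⟨((hk.measurable_mul f).comp measurable_prodMk_left).aestronglyMeasurable,
    (ENNReal.pow_lt_top_iff.mp hx).resolve_right two_ne_zero⟩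

lemma eLpNorm_integral_le (hk : IsBoundedKernel k C μ ν) (f : Lp ℝ 2 ν) :
    eLpNorm (fun x => ∫ y, k x y * f y ∂ν) 2 μ ≤ C * ‖f‖ₑ :=
  (eLpNorm_mono_enorm fun _ => enorm_integral_le_lintegral_enorm _).trans
    (hk.eLpNorm_lintegral_le f)

lemma memLp_integral [SFinite ν] (hk : IsBoundedKernel k C μ ν) (f : Lp ℝ 2 ν) :
    MemLp (fun x => ∫ y, k x y * f y ∂ν) 2 μ :=
  ⟨(hk.measurable_mul f).stronglyMeasurable.integral_prod_right.aestronglyMeasurable,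
    (hk.eLpNorm_integral_le f).trans_lt (by finiteness)⟩

theorem exists_isIntegralOperator [SFinite ν] (hk : IsBoundedKernel k C μ ν) :
    ∃ A : Lp ℝ 2 ν →L[ℝ] Lp ℝ 2 μ, IsIntegralOperator k A := by
  let A : Lp ℝ 2 ν →ₗ[ℝ] Lp ℝ 2 μ :=
    { toFun := fun f => (hk.memLp_integral f).toLp _
      map_add' := fun f g => by
        rw [← MemLp.toLp_add]
        refine MemLp.toLp_congr _ _ ?_
        filter_upwards [hk.ae_integrable f, hk.ae_integrable g] with x hf hg
        rw [Pi.add_apply, ← integral_add hf hg]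
        refine integral_congr_ae ?_
        filter_upwards [Lp.coeFn_add f g] with y hy
        rw [hy, Pi.add_apply, mul_add]
      map_smul' := fun c f => by
        rw [RingHom.id_apply, ← MemLp.toLp_const_smul]
        refine MemLp.toLp_congr _ _ (ae_of_all _ fun x => ?_)
        rw [Pi.smul_apply, smul_eq_mul, ← integral_const_mul]
        refine integral_congr_ae ?_
        filter_upwards [Lp.coeFn_smul c f] with y hy
        rw [hy, Pi.smul_apply, smul_eq_mul, mul_left_comm] }
  refine ⟨A.mkContinuous C fun f => ?_, fun f => (hk.memLp_integral f).coeFn_toLp⟩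
  have hle : ‖A f‖ₑ ≤ ‖(C : ℝ) * ‖f‖‖ₑ := by
    rw [enorm_mul, enorm_norm, Real.enorm_of_nonneg C.coe_nonneg, ENNReal.ofReal_coe_nnreal]
    exact (Lp.enorm_toLp (hf := hk.memLp_integral f)).trans_le (hk.eLpNorm_integral_le f)
  exact (enorm_le_iff_norm_le.mp hle).trans_eq (Real.norm_of_nonneg (by positivity))

end IsBoundedKernel

end IntegralOperator

/-! ### The weighted fractional integration operator -/

section FracOperator

variable {α p T t : ℝ}

lemma ae_mem_Ioc (T : ℝ) : ∀ᵐ x ∂volume.restrict (Set.Icc 0 T), x ∈ Set.Ioc 0 T := by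
  rw [← restrict_Ioc_eq_restrict_Icc]
  exact ae_restrict_mem measurableSet_Ioc

theorem exists_isBoundedKernel_fracKernel (hp : 0 < p) (hα : α < 1 / 2) (T : ℝ) :
    ∃ C, IsBoundedKernel (fracKernel α p) C (volume.restrict (Set.Icc 0 T))
      (volume.restrict (Set.Icc 0 T)) := by
  have hweight : Measurable fun s : ℝ => ‖(s ^ α)⁻¹‖ₑ := by fun_prop
  refine ⟨_, IsBoundedKernel.of_schur (measurable_fracKernel α p) hweight hweight ?_
    (ae_of_all _ fun s => enorm_ne_top) (C₁ := ‖T ^ p / Real.Gamma (p + 1)‖₊)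
    (C₂ := ‖T ^ p * (Real.Gamma (1 - 2 * α) / Real.Gamma (1 - 2 * α + p))‖₊)
    (ae_of_all _ fun s => ?_) ?_⟩
  · filter_upwards [ae_mem_Ioc T] with s hs
    exact enorm_ne_zero.mpr (inv_ne_zero (Real.rpow_pos_of_pos hs.1 α).ne')
  · refine (lintegral_mono_set' ?_).trans (lintegral_Iio_fracKernel_mul_weight_le hp s T)
    exact Set.Icc_subset_Iic_self.eventuallyLE.trans Iio_ae_eq_Iic.symm.le
  · filter_upwards [ae_mem_Ioc T] with u hu
    have hpow : ‖u ^ p‖ₑ ≤ ‖T ^ p‖ₑ := by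
      rw [Real.enorm_of_nonneg (Real.rpow_nonneg hu.1.le p),
        Real.enorm_of_nonneg (Real.rpow_nonneg (hu.1.le.trans hu.2) p)]
      exact ENNReal.ofReal_le_ofReal (Real.rpow_le_rpow hu.1.le hu.2 hp.le)
    refine (setLIntegral_le_lintegral _ _).trans ?_
    rw [lintegral_weight_mul_fracKernel hp hα hu.1, ← enorm_eq_nnnorm, enorm_mul, enorm_mul]
    gcongr

lemma fracOperator_pow_indLp (hα : 0 ≤ α) (hp : 0 < p) (ht : t ≤ T)
    {R : L2Icc T →L[ℝ] L2Icc T} (hR : IsIntegralOperator (fracKernel α p) R) (n : ℕ) :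
    (R ^ (n + 1)) (indLp T t)
      =ᵐ[volume.restrict (Set.Icc 0 T)] fracPrim α ((n + 1 : ℕ) * p) t := by
  induction n with
  | zero =>
    filter_upwards [hR.apply_ae_eq (indLp_coeFn T t)] with s hs
    rw [zero_add, pow_one, hs, integral_fracKernel_mul_ind ht, Nat.cast_one, one_mul]
  | succ n ih =>
    rw [pow_succ']
    filter_upwards [hR.apply_ae_eq ih] with s hs
    rw [mul_apply_eq_comp, hs,
      integral_fracKernel_mul_fracPrim hα hp (by positivity) ht]
    push_cast
    ring_nf

end FracOperator

/-! ### Neumann series -/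

lemma tsum_pow_apply_eq {𝕜 E : Type*} [Semiring 𝕜] [AddCommGroup E] [Module 𝕜 E]
    [TopologicalSpace E] [IsTopologicalAddGroup E] [T2Space E] (S : E →L[𝕜] E) {x : E}
    (hsum : Summable fun n : ℕ => (S ^ n) x) :
    ∑' n : ℕ, (S ^ n) x = x + S (∑' n : ℕ, (S ^ n) x) := by
  conv_lhs => rw [hsum.tsum_eq_zero_add]
  simp only [S.map_tsum hsum, pow_succ', pow_zero, mul_apply_eq_comp, one_apply_eq_self]

section FracNeumann

variable {α p T t s : ℝ}

lemma abs_pow_mul_fracPrim_le (hα : 0 ≤ α) (hp : 0 < p) (ht : 0 ≤ t) (hs : 0 ≤ s) (ρ : ℝ)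
    (n : ℕ) :
    |ρ ^ (n + 1) * fracPrim α ((n + 1 : ℕ) * p) t s|
      ≤ t ^ α * ((|ρ| * t ^ p) ^ (n + 1) / Real.Gamma ((n + 1 : ℕ) * p + 1)) * (s ^ α)⁻¹ := by
  have hpow : t ^ ((n + 1 : ℕ) * p) = (t ^ p) ^ (n + 1) := by
    rw [mul_comm, Real.rpow_mul ht, Real.rpow_natCast]
  calc |ρ ^ (n + 1) * fracPrim α ((n + 1 : ℕ) * p) t s|
      = |ρ| ^ (n + 1) * |fracPrim α ((n + 1 : ℕ) * p) t s| := by rw [abs_mul, abs_pow]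
    _ ≤ |ρ| ^ (n + 1) * (t ^ α * (t ^ ((n + 1 : ℕ) * p) / Real.Gamma ((n + 1 : ℕ) * p + 1))
        * (s ^ α)⁻¹) := by
        gcongr
        exact abs_fracPrim_le hα (by positivity) ht hs
    _ = _ := by
        rw [hpow, mul_pow]
        ring

lemma summable_pow_mul_fracPrim_bound (hp : 0 < p) (α t ρ : ℝ) :
    Summable fun n : ℕ =>
      t ^ α * ((|ρ| * t ^ p) ^ (n + 1) / Real.Gamma ((n + 1 : ℕ) * p + 1)) :=
  ((summable_nat_add_iff 1).mpr (summable_pow_div_Gamma hp (|ρ| * t ^ p))).mul_left _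

lemma summable_pow_mul_fracPrim (hα : 0 ≤ α) (hp : 0 < p) (ht : 0 ≤ t) (hs : 0 ≤ s) (ρ : ℝ) :
    Summable fun n : ℕ => ρ ^ (n + 1) * fracPrim α ((n + 1 : ℕ) * p) t s :=
  ((summable_pow_mul_fracPrim_bound hp α t ρ).mul_right _).of_norm_bounded
    fun n => abs_pow_mul_fracPrim_le hα hp ht hs ρ n

lemma memLp_inv_rpow (hα : α < 1 / 2) (T : ℝ) :
    MemLp (fun s : ℝ => (s ^ α)⁻¹) 2 (volume.restrict (Set.Icc 0 T)) := by
  rw [memLp_two_iff_integrable_sq (by fun_prop), ← restrict_Ioc_eq_restrict_Icc]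
  have hrpow := (intervalIntegral.intervalIntegrable_rpow' (a := 0) (b := T) (r := -(2 * α))
    (by linarith)).1
  refine hrpow.congr ?_
  filter_upwards [ae_restrict_mem measurableSet_Ioc] with s hs
  rw [Real.rpow_neg hs.1.le, inv_pow, mul_comm, Real.rpow_mul hs.1.le, Real.rpow_two]

variable {R : L2Icc T →L[ℝ] L2Icc T}

lemma smul_fracOperator_pow_indLp (hα : 0 ≤ α) (hp : 0 < p) (ht : t ≤ T)
    (hR : IsIntegralOperator (fracKernel α p) R) (ρ : ℝ) (n : ℕ) :
    ((ρ • R) ^ (n + 1)) (indLp T t) =ᵐ[volume.restrict (Set.Icc 0 T)]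
      fun s => ρ ^ (n + 1) * fracPrim α ((n + 1 : ℕ) * p) t s := by
  rw [smul_pow]
  filter_upwards [Lp.coeFn_smul (ρ ^ (n + 1)) ((R ^ (n + 1)) (indLp T t)),
    fracOperator_pow_indLp hα hp ht hR n] with s hsmul hpow
  rw [smul_apply, hsmul, Pi.smul_apply, hpow, smul_eq_mul]

lemma summable_norm_smul_fracOperator_pow_indLp (hα : 0 ≤ α) (hα' : α < 1 / 2) (hp : 0 < p)
    (ht : t ∈ Set.Icc 0 T) (hR : IsIntegralOperator (fracKernel α p) R) (ρ : ℝ) :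
    Summable fun n : ℕ => ‖((ρ • R) ^ n) (indLp T t)‖ := by
  have hw := (memLp_inv_rpow hα' T).coeFn_toLp
  refine (summable_nat_add_iff 1).mp (Summable.of_nonneg_of_le (fun n => norm_nonneg _)
    (fun n => Lp.norm_le_mul_norm_of_ae_le_mul ?_)
    ((summable_pow_mul_fracPrim_bound hp α t ρ).mul_right ‖(memLp_inv_rpow hα' T).toLp‖))
  filter_upwards [smul_fracOperator_pow_indLp hα hp ht.2 hR ρ n, hw, ae_mem_Ioc T]
    with s hpow hws hs
  rw [hpow, hws, Real.norm_of_nonneg (inv_nonneg.mpr (Real.rpow_nonneg hs.1.le α))]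
  exact abs_pow_mul_fracPrim_le hα hp ht.1 hs.1.le ρ n

lemma tsum_smul_fracOperator_pow_indLp (hα : 0 ≤ α) (hα' : α < 1 / 2) (hp : 0 < p)
    (ht : t ∈ Set.Icc 0 T) (hR : IsIntegralOperator (fracKernel α p) R) (ρ : ℝ) :
    (∑' n : ℕ, ((ρ • R) ^ n) (indLp T t) : L2Icc T) =ᵐ[volume.restrict (Set.Icc 0 T)]
      fun s => ind t s + ∑' n : ℕ, ρ ^ (n + 1) * fracPrim α ((n + 1 : ℕ) * p) t s := by
  have hsum := summable_norm_smul_fracOperator_pow_indLp hα hα' hp ht hR ρ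
  filter_upwards [Lp.hasSum_coeFn_tsum (tsum_enorm_ne_top_iff_summable_norm.mpr hsum),
    ae_all_iff.mpr (smul_fracOperator_pow_indLp hα hp ht.2 hR ρ), indLp_coeFn T t]
    with s hs hpow hind
  rw [← hs.tsum_eq, hs.summable.tsum_eq_zero_add, pow_zero, one_apply_eq_self, hind]
  simp only [hpow]

end FracNeumann

/-! ### The kernels `L` and `L⁻¹` -/

/-- The factor `c(H) Γ(H - 1/2)` between `K_H(t,·)` and the weighted fractional integral of `𝟏_t` of
order `H - 1/2`. -/
def fracCoeff (H : ℝ) : ℝ := mgConst H * Real.Gamma (H - 1 / 2)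

section Kernels

variable {a H T t s : ℝ}

lemma gammaKernel_eq_fracPrim (hH : H ≠ 1 / 2) (k : ℕ) (t : ℝ) (hs : 0 ≤ s) :
    gammaKernel H k t s = fracCoeff H ^ k * fracPrim (H - 1 / 2) (k * (H - 1 / 2)) t s := by
  rw [gammaKernel]
  split_ifs with hst
  · rcases hs.eq_or_lt with rfl | hs
    · rw [fracPrim_eq_zero fun h => h.1.false, Real.zero_rpow (sub_ne_zero.mpr hH)]
      simp
    · rw [fracPrim_eq_intervalIntegral hs hst, fracCoeff, mul_pow]
      ring
  · rw [fracPrim_eq_zero fun h => hst h.2, mul_zero]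

lemma mgKernel_eq_gammaKernel_one (hH : 1 / 2 < H) (t s : ℝ) :
    mgKernel H t s = gammaKernel H 1 t s := by
  rw [mgKernel, gammaKernel]
  split_ifs with hst
  · have hintegrand : Set.EqOn (fun u => u ^ (H - 1 / 2) / (u - s) ^ (3 / 2 - H))
        (fun u => u ^ (H - 1 / 2) * (u - s) ^ (H - 1 / 2 - 1)) (Set.uIcc s t) := by
      intro u hu
      rw [Set.uIcc_of_le hst.le] at hu
      dsimp only
      rw [div_eq_mul_inv, ← Real.rpow_neg (sub_nonneg.mpr hu.1)]
      ring_nf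
    have hGamma := (Real.Gamma_pos_of_pos (sub_pos.mpr hH)).ne'
    rw [intervalIntegral.integral_congr hintegrand, pow_one, pow_one, Nat.cast_one, one_mul,
      mul_div_cancel_right₀ _ hGamma]
  · rfl

lemma mgKernel_eq_fracPrim (hH : 1 / 2 < H) (t : ℝ) (hs : 0 ≤ s) :
    mgKernel H t s = fracCoeff H * fracPrim (H - 1 / 2) (H - 1 / 2) t s := by
  rw [mgKernel_eq_gammaKernel_one hH, gammaKernel_eq_fracPrim hH.ne' 1 t hs, pow_one,
    Nat.cast_one, one_mul]

lemma kernelLinvTerm_eq_fracPrim (hH : H ≠ 1 / 2) (a b t : ℝ) (hs : 0 ≤ s) (n : ℕ) :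
    kernelLinvTerm a b H t s n = (-(b / a * fracCoeff H)) ^ (n + 1)
      * fracPrim (H - 1 / 2) ((n + 1 : ℕ) * (H - 1 / 2)) t s := by
  rw [kernelLinvTerm, gammaKernel_eq_fracPrim hH _ t hs, neg_pow (b / a * _), mul_pow (b / a)]
  ring

lemma summable_kernelLinvTerm (hH : 1 / 2 < H) (a b : ℝ) (ht : 0 ≤ t) (hs : 0 ≤ s) :
    Summable (kernelLinvTerm a b H t s) := by
  have hα : 0 < H - 1 / 2 := sub_pos.mpr hH
  exact (summable_pow_mul_fracPrim hα.le hα ht hs (-(b / a * fracCoeff H))).congr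
    fun n => (kernelLinvTerm_eq_fracPrim hH.ne' a b t hs n).symm

lemma indicator_kernelL (a b H t : ℝ) :
    (Set.Ico 0 t).indicator (kernelL a b H t)
      = fun s => a * ind t s + b * (Set.Ico 0 t).indicator (mgKernel H t) s := by
  ext s
  by_cases hs : s ∈ Set.Ico 0 t
  · simp only [Set.indicator_of_mem hs, kernelL]
  · simp only [Set.indicator_of_notMem hs, ind, mul_zero, add_zero]

lemma indicator_mgKernel (H t : ℝ) (hs : 0 ≤ s) :
    (Set.Ico 0 t).indicator (mgKernel H t) s = mgKernel H t s :=
  Set.indicator_apply_eq_self.mpr fun hst => if_neg fun h => hst ⟨hs, h⟩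

lemma indicator_kernelLinv (a b H t : ℝ) (hs : 0 ≤ s) :
    (Set.Ico 0 t).indicator (kernelLinv a b H t) s = kernelLinv a b H t s := by
  refine Set.indicator_apply_eq_self.mpr fun hst => ?_
  have hst' : ¬ s < t := fun h => hst ⟨hs, h⟩
  simp [kernelLinv, ind, kernelLinvTerm, gammaKernel, hst']

/-- The operator `a + b c(H) Γ(H - 1/2) R`. When `R` is the weighted fractional integral of order
`H - 1/2`, it sends `𝟏_t` to `L(t,·)`. -/
def mixedOperator (a b H : ℝ) (R : L2Icc T →L[ℝ] L2Icc T) : L2Icc T →L[ℝ] L2Icc T :=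
  a • 1 + (b * fracCoeff H) • R

lemma mixedOperator_apply (a b H : ℝ) (R : L2Icc T →L[ℝ] L2Icc T) (u : L2Icc T) :
    mixedOperator a b H R u = a • u + (b * fracCoeff H) • R u := rfl

lemma mixedOperator_indLp (hH : 1 / 2 < H) (ht : t ≤ T) {R : L2Icc T →L[ℝ] L2Icc T}
    (hR : IsIntegralOperator (fracKernel (H - 1 / 2) (H - 1 / 2)) R) (a b : ℝ) :
    mixedOperator a b H R (indLp T t) =ᵐ[volume.restrict (Set.Icc 0 T)]
      (Set.Ico 0 t).indicator (kernelL a b H t) := by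
  rw [mixedOperator_apply, indicator_kernelL]
  filter_upwards [coeFn_smul_add_smul (indLp_coeFn T t) (hR.apply_ae_eq (indLp_coeFn T t)) a
    (b * fracCoeff H), ae_mem_Ioc T] with s hcomb hs
  rw [hcomb, integral_fracKernel_mul_ind ht, indicator_mgKernel H t hs.1.le,
    mgKernel_eq_fracPrim hH t hs.1.le, mul_assoc b]

lemma mixedOperator_inv_smul_tsum (ha : a ≠ 0) (b H : ℝ) (R : L2Icc T →L[ℝ] L2Icc T)
    {u : L2Icc T} (hsum : Summable fun n : ℕ => ((-(b / a * fracCoeff H) • R) ^ n) u) :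
    mixedOperator a b H R (a⁻¹ • ∑' n : ℕ, ((-(b / a * fracCoeff H) • R) ^ n) u) = u := by
  have hneumann := tsum_pow_apply_eq _ hsum
  set v := ∑' n : ℕ, ((-(b / a * fracCoeff H) • R) ^ n) u
  rw [mixedOperator_apply, map_smul, smul_inv_smul₀ ha, smul_smul,
    show b * fracCoeff H * a⁻¹ = -(-(b / a * fracCoeff H)) by ring, neg_smul, ← sub_eq_add_neg,
    sub_eq_iff_eq_add]
  exact hneumann

lemma inv_smul_tsum_coeFn (hH : H ∈ Set.Ioo (1 / 2 : ℝ) 1) (ht : t ∈ Set.Icc 0 T)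
    {R : L2Icc T →L[ℝ] L2Icc T}
    (hR : IsIntegralOperator (fracKernel (H - 1 / 2) (H - 1 / 2)) R) (a b : ℝ) :
    (a⁻¹ • ∑' n : ℕ, ((-(b / a * fracCoeff H) • R) ^ n) (indLp T t) : L2Icc T)
      =ᵐ[volume.restrict (Set.Icc 0 T)] (Set.Ico 0 t).indicator (kernelLinv a b H t) := by
  have hα : 0 < H - 1 / 2 := sub_pos.mpr hH.1
  have hα' : H - 1 / 2 < 1 / 2 := by linarith [hH.2]
  filter_upwards [Lp.coeFn_smul a⁻¹ (∑' n : ℕ, ((-(b / a * fracCoeff H) • R) ^ n) (indLp T t)),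
    tsum_smul_fracOperator_pow_indLp hα.le hα' hα ht hR (-(b / a * fracCoeff H)), ae_mem_Ioc T]
    with s hsmul htsum hs
  rw [hsmul, Pi.smul_apply, htsum, smul_eq_mul, indicator_kernelLinv a b H t hs.1.le, kernelLinv,
    mul_add, one_div a]
  simp only [kernelLinvTerm_eq_fracPrim hH.1.ne' a b t hs.1.le]

theorem exists_operator_kernelL_kernelLinv (ha : a ≠ 0) (b : ℝ) (hH : H ∈ Set.Ioo (1 / 2 : ℝ) 1)
    (T : ℝ) :
    ∃ D : L2Icc T →L[ℝ] L2Icc T, ∀ t ∈ Set.Icc 0 T,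
      D (indLp T t) =ᵐ[volume.restrict (Set.Icc 0 T)]
        (Set.Ico 0 t).indicator (kernelL a b H t) ∧
      ∃ v : L2Icc T, v =ᵐ[volume.restrict (Set.Icc 0 T)]
        (Set.Ico 0 t).indicator (kernelLinv a b H t) ∧ D v = indLp T t := by
  have hα : 0 < H - 1 / 2 := sub_pos.mpr hH.1
  have hα' : H - 1 / 2 < 1 / 2 := by linarith [hH.2]
  obtain ⟨C, hC⟩ := exists_isBoundedKernel_fracKernel hα hα' T
  obtain ⟨R, hR⟩ := hC.exists_isIntegralOperator
  refine ⟨mixedOperator a b H R, fun t ht => ⟨mixedOperator_indLp hH.1 ht.2 hR a b, _,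
    inv_smul_tsum_coeFn hH ht hR a b, mixedOperator_inv_smul_tsum ha b H R ?_⟩⟩
  exact (summable_norm_smul_fracOperator_pow_indLp hα.le hα' hα ht hR _).of_norm

end Kernels

lemma IsCCMFBM.isWienerIntegralUpTo_kernelL {Ω : Type*} [MeasurableSpace Ω] {P : Measure Ω}
    {T a b H : ℝ} {B X : ℝ → Ω → ℝ} (hX : IsCCMFBM P T a b H B X)
    {I : L2Icc T →L[ℝ] Lp ℝ 2 P} (hI : IsWienerMap P T B I) {t : ℝ} (ht : t ∈ Set.Icc 0 T) :
    IsWienerIntegralUpTo P T B t (kernelL a b H t) (X t) := by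
  obtain ⟨BH, hBH, hmix⟩ := hX.eq_mix
  have hcomb := hI.isWienerIntegral_linearComb (hI.isWienerIntegral_ind ht) (hBH t ht) a b
  rw [IsWienerIntegralUpTo, indicator_kernelL]
  have hclass := hcomb.memLp_integrand.coeFn_toLp
  exact (hI.isWienerIntegral_iff hclass).mpr
    (((hI.isWienerIntegral_iff hclass).mp hcomb).trans (hmix t ht).symm)

end CCMFBM

end

open CCMFBM in
theorem mainTheorem1 {Ω : Type*} [MeasurableSpace Ω] (P : Measure Ω) [IsProbabilityMeasure P]
    (T a b H : ℝ) (hT : 0 < T) (hab : a * b ≠ 0) (hH : H ∈ Set.Ioo (1 / 2 : ℝ) 1)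
    (B X : ℝ → Ω → ℝ) (hX : CCMFBM.IsCCMFBM P T a b H B X) :
    -- the series that defines `L⁻¹(t,s)` converges
    (∀ t ∈ Set.Icc 0 T, ∀ s ∈ Set.Icc 0 T, Summable (CCMFBM.kernelLinvTerm a b H t s)) ∧
    -- the abstract Wiener integrals `∫_0^t L⁻¹(t,s) dX_s` exist
    (∀ t ∈ Set.Icc 0 T, ∃ Y : Ω → ℝ,
      CCMFBM.IsWienerIntegralUpTo P T X t (fun s => CCMFBM.kernelLinv a b H t s) Y) ∧
    -- the process `W` that they define
    ∀ W : ℝ → Ω → ℝ,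
      (∀ t ∈ Set.Icc 0 T,
        CCMFBM.IsWienerIntegralUpTo P T X t (fun s => CCMFBM.kernelLinv a b H t s) (W t)) →
      -- is a Brownian motion (after a modification, as each `W_t` is defined up to a null set),
      CCMFBM.IsPreBrownianOn P T W ∧
      (∃ V : ℝ → Ω → ℝ, CCMFBM.IsBrownianOn P T V ∧ ∀ t ∈ Set.Icc 0 T, V t =ᵐ[P] W t) ∧
      -- it reconstructs `X`,
      (∀ t ∈ Set.Icc 0 T,
        CCMFBM.IsWienerIntegralUpTo P T W t (fun s => CCMFBM.kernelL a b H t s) (X t)) ∧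
      -- and it is the Brownian motion that drives `X`
      (∀ t ∈ Set.Icc 0 T, W t =ᵐ[P] B t) := by
  obtain ⟨I, hI⟩ := hX.brownian.toIsPreBrownianOn.exists_isWienerMap
  obtain ⟨D, hD⟩ := exists_operator_kernelL_kernelLinv (left_ne_zero_of_mul hab) b hH T
  have hXB : ∀ t ∈ Set.Icc 0 T, IsWienerIntegralUpTo P T B t (kernelL a b H t) (X t) :=
    fun t ht => hX.isWienerIntegralUpTo_kernelL hI ht
  have hID : IsWienerMap P T X (I.comp D) := hI.comp (fun t ht => (hD t ht).1) hXB
  have hLinv : ∀ t ∈ Set.Icc 0 T, ∀ Y : Ω → ℝ,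
      IsWienerIntegralUpTo P T X t (kernelLinv a b H t) Y ↔ B t =ᵐ[P] Y := by
    intro t ht Y
    obtain ⟨v, hv, hDv⟩ := (hD t ht).2
    rw [IsWienerIntegralUpTo, hID.isWienerIntegral_iff hv, ContinuousLinearMap.comp_apply, hDv]
    exact ⟨(hI t ht).symm.trans, (hI t ht).trans⟩
  refine ⟨fun t ht s hs => summable_kernelLinvTerm hH.1 a b ht.1 hs.1,
    fun t ht => ⟨B t, (hLinv t ht _).mpr .rfl⟩, fun W hW => ?_⟩
  have hWB : ∀ t ∈ Set.Icc 0 T, W t =ᵐ[P] B t :=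
    fun t ht => ((hLinv t ht _).mp (hW t ht)).symm
  have hIW : IsWienerMap P T W I := hI.congr hWB
  refine ⟨hX.brownian.toIsPreBrownianOn.congr hWB,
    ⟨B, hX.brownian, fun t ht => (hWB t ht).symm⟩, fun t ht => ?_, hWB⟩
  have hL := (hD t ht).1
  exact (hIW.isWienerIntegral_iff hL).mpr ((hI.isWienerIntegral_iff hL).mp (hXB t ht))
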